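/- Let $A$ and $B$ be finite-dimensional quantum systems with $d_A=\dim A\ge 1$, $d_B=\dim B$, and let $\Lambda$ be a quantum channel from $A$ to $B$, that is, a completely positive trace-preserving linear map. Let $$\varrho(\Lambda)=(\mathrm{id}_A\otimes\Lambda)(P_+),\qquad P_+=\frac1{d_A}\sum_{i,j}|ii\rangle\langle jj|,$$ be its Choi–Jamiołkowski state on $A\otimes B$. A state $\rho_{AB}$ is called symmetrically extendible if there is a state $\rho_{ABB'}$ on $A\otimes B\otimes B'$, with $B'$ a copy of $B$, that is invariant under the exchange of $B$ and $B'$ ($\rho_{ABB'}=\rho_{AB'B}$) and satisfies $\mathrm{Tr}_{B'}\,\rho_{ABB'}=\rho_{AB}$. The one-way quantum capacity $Q_\to(\Lambda)\in[0,\infty]$ is the supremum of all $R\ge 0$ such that for every $\varepsilon>0$ and all sufficiently large $n$ there are $k\ge 2^{nR}$, a quantum instrument $(\mathcal E_x)_{x}$ with finitely many outcomes $x$ (completely positive maps from the operators on $\mathbb C^k$ to those on $A^{\otimes n}$ whose sum is trace preserving), and for each $x$ a channel $\mathcal D_x$ from $B^{\otimes n}$ to $\mathbb C^k$, such that $T=\sum_x\mathcal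 D_x\circ\Lambda^{\otimes n}\circ\mathcal E_x$ satisfies $\langle\psi|T(|\psi\rangle\langle\psi|)|\psi\rangle\ge 1-\varepsilon$ for every unit vector $\psi\in\mathbb C^k$. (The sender transmits the outcome $x$ to the receiver over a noiseless forward classical channel.) Then: 1. If $\varrho(\Lambda)$ is symmetrically extendible, then $Q_\to(\Lambda)=0$. 2. The hypothesis of 1 can be tested by a semidefinite program: $\varrho(\Lambda)$ is symmetrically extendible if and only if the following standard-form semidefinite program, written with $\rho=\varrho(\Lambda)$, is feasible. Its objective is zero, its variable is a positive semidefinite matrix $X$ on $A\otimes B\otimes B'$, of order $d_Ad_B^2$, and its constraints are the linear equations $$\mathrm{Tr}\big((H\otimes 1_{B'})X\big)=\mathrm{Re}\,\mathrm{Tr}(H\rho),\qquad \mathrm{Tr}\big((H'-VH'V)X\big)=0,$$ where $V$ exchanges $B$ and $B'$, and $H$, respectively $H'$, runs through the Hermitian matrices $E_{ij}+E_{ji}$ and $\mathrm i(E_{ij}-E_{ji})$ on $A\otimes B$, respectively on $A\otimes B\otimes B'$, with $(i,j)$ running through all ordered pairs of basis indices. The number of constraints is $2(d_Ad_B)^2+2(d_Ad_B^2)^2$.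 In particular, feasibility of this program certifies $Q_\to(\Lambda)=0$. -/

import Mathlib

open Matrix Filter
open scoped NNReal ENNReal ComplexOrder

/-! Finite-dimensional quantum systems. A system is a finite type `A` (its computational basis);
its Hilbert space is `A → ℂ` and its operators are `Matrix A A ℂ`. -/

namespace QInfo

section Channels

variable {A B : Type*}

/-- A density matrix: positive semidefinite with trace one. -/
def IsDensity [Fintype A] (ρ : Matrix A A ℂ) : Prop :=
  ρ.PosSemidef ∧ ρ.trace = 1

/-- `id_R ⊗ Φ`: the map `Φ` applied to each block of an operator on `R ⊗ A`. -/
def ampliate (R : Type*) (Φ : Matrix A A ℂ →ₗ[ℂ] Matrix B B ℂ) :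
    Matrix (R × A) (R × A) ℂ →ₗ[ℂ] Matrix (R × B) (R × B) ℂ where
  toFun X := Matrix.of fun p q =>
    Φ (Matrix.of fun a a' => X (p.1, a) (q.1, a')) p.2 q.2
  map_add' X Y := by
    ext p q
    exact congrFun (congrFun (Φ.map_add (Matrix.of fun a a' => X (p.1, a) (q.1, a'))
      (Matrix.of fun a a' => Y (p.1, a) (q.1, a'))) p.2) q.2
  map_smul' c X := by
    ext p q
    exact congrFun (congrFun (Φ.map_smul c
      (Matrix.of fun a a' => X (p.1, a) (q.1, a'))) p.2) q.2

/-- Complete positivity: `id_k ⊗ Φ` preserves positive semidefiniteness for every `k`. -/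
def IsCompletelyPositive (Φ : Matrix A A ℂ →ₗ[ℂ] Matrix B B ℂ) : Prop :=
  ∀ (k : ℕ) (X : Matrix (Fin k × A) (Fin k × A) ℂ),
    X.PosSemidef → (ampliate (Fin k) Φ X).PosSemidef

/-- A quantum channel: a completely positive trace-preserving linear map. -/
def IsChannel [Fintype A] [Fintype B] (Φ : Matrix A A ℂ →ₗ[ℂ] Matrix B B ℂ) : Prop :=
  IsCompletelyPositive Φ ∧ ∀ X, (Φ X).trace = X.trace

/-- `Φ^{⊗ n}`, by linear extension from the matrix units
`|a₁⟩⟨a₁'| ⊗ ⋯ ⊗ |aₙ⟩⟨aₙ'| ↦ Φ(|a₁⟩⟨a₁'|) ⊗ ⋯ ⊗ Φ(|aₙ⟩⟨aₙ'|)`. -/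
def tensorPower [Fintype A] [DecidableEq A] (n : ℕ) (Φ : Matrix A A ℂ →ₗ[ℂ] Matrix B B ℂ) :
    Matrix (Fin n → A) (Fin n → A) ℂ →ₗ[ℂ] Matrix (Fin n → B) (Fin n → B) ℂ where
  toFun X := Matrix.of fun b b' =>
    ∑ a, ∑ a', X a a' * ∏ i, Φ (Matrix.single (a i) (a' i) 1) (b i) (b' i)
  map_add' X Y := by
    ext b b'
    simp [add_mul, Finset.sum_add_distrib]
  map_smul' c X := by
    ext b b'
    simp [Finset.mul_sum, mul_assoc]

/-- The maximally entangled state `P₊ = (1/d) ∑ |i i⟩⟨j j|` on `A ⊗ A`, `d = dim A`. -/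
noncomputable def maxEntangled (A : Type*) [Fintype A] [DecidableEq A] :
    Matrix (A × A) (A × A) ℂ :=
  Matrix.of fun p q => if p.1 = p.2 ∧ q.1 = q.2 then (Fintype.card A : ℂ)⁻¹ else 0

/-- The Choi–Jamiołkowski state `ϱ(Φ) = (id_A ⊗ Φ)(P₊)` on `A ⊗ B`. -/
noncomputable def choiState [Fintype A] [DecidableEq A] (Φ : Matrix A A ℂ →ₗ[ℂ] Matrix B B ℂ) :
    Matrix (A × B) (A × B) ℂ :=
  ampliate A Φ (maxEntangled A)

end Channels

section Extensions

variable {A B : Type*}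

/-- The exchange of the two `B` factors of `A ⊗ B ⊗ B'`. -/
def swapLast (p : A × B × B) : A × B × B := (p.1, p.2.2, p.2.1)

/-- The partial trace over the last factor, `Tr_{B'}`. -/
def traceLast [Fintype B] (σ : Matrix (A × B × B) (A × B × B) ℂ) : Matrix (A × B) (A × B) ℂ :=
  Matrix.of fun p q => ∑ c, σ (p.1, p.2, c) (q.1, q.2, c)

/-- `ρ_{AB}` has a symmetric extension: a state `ρ_{ABB'}` with `ρ_{ABB'} = ρ_{AB'B}` and
`Tr_{B'} ρ_{ABB'} = ρ_{AB}`. -/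
def SymmetricallyExtendible [Fintype A] [Fintype B] (ρ : Matrix (A × B) (A × B) ℂ) : Prop :=
  ∃ σ : Matrix (A × B × B) (A × B × B) ℂ,
    IsDensity σ ∧ σ.submatrix swapLast swapLast = σ ∧ traceLast σ = ρ

end Extensions

section Capacity

variable {A B : Type*} [Fintype A] [DecidableEq A]

/-- A code for sending a `k`-dimensional quantum system by `n` uses of a channel from `A` to `B`
together with noiseless forward classical communication. Alice applies a quantum instrument
`(enc x)_x` to the system, feeds the quantum output to the `n` channel inputs and tells Bob the
outcome `x`; Bob applies to the `n` channel outputs a channel `dec x` that may depend on `x`. -/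
structure OneWayCode (A B : Type*) [Fintype A] [Fintype B] (n k : ℕ) where
  /-- number of classical messages -/
  messages : ℕ
  enc : Fin messages → (Matrix (Fin k) (Fin k) ℂ →ₗ[ℂ] Matrix (Fin n → A) (Fin n → A) ℂ)
  enc_cp : ∀ x, IsCompletelyPositive (enc x)
  enc_trace : ∀ X, ∑ x, (enc x X).trace = X.trace
  dec : Fin messages → (Matrix (Fin n → B) (Fin n → B) ℂ →ₗ[ℂ] Matrix (Fin k) (Fin k) ℂ)
  dec_channel : ∀ x, IsChannel (dec x)

variable [Fintype B]

/-- The overall map `∑ₓ dec x ∘ Λ^{⊗ n} ∘ enc x` produced by a code over the channel `Λ`. -/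
def OneWayCode.transmit {n k : ℕ} (c : OneWayCode A B n k)
    (Λ : Matrix A A ℂ →ₗ[ℂ] Matrix B B ℂ) :
    Matrix (Fin k) (Fin k) ℂ →ₗ[ℂ] Matrix (Fin k) (Fin k) ℂ :=
  ∑ x, c.dec x ∘ₗ tensorPower n Λ ∘ₗ c.enc x

/-- Every pure state `|ψ⟩⟨ψ|` is transmitted with fidelity `⟨ψ| T(|ψ⟩⟨ψ|) |ψ⟩ ≥ f`. -/
def MinFidelityGE {k : ℕ} (T : Matrix (Fin k) (Fin k) ℂ →ₗ[ℂ] Matrix (Fin k) (Fin k) ℂ)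
    (f : ℝ) : Prop :=
  ∀ ψ : Fin k → ℂ, star ψ ⬝ᵥ ψ = 1 → f ≤ (star ψ ⬝ᵥ (T (vecMulVec ψ (star ψ)) *ᵥ ψ)).re

/-- `R` (in qubits per channel use) is an achievable rate: for every `ε > 0` and all large `n`
there is a code on a space of dimension at least `2 ^ (n R)` with fidelity at least `1 - ε`. -/
def OneWayAchievable (Λ : Matrix A A ℂ →ₗ[ℂ] Matrix B B ℂ) (R : ℝ≥0) : Prop :=
  ∀ ε : ℝ, 0 < ε → ∀ᶠ n : ℕ in atTop, ∃ (k : ℕ) (c : OneWayCode A B n k),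
    (2 : ℝ) ^ ((n : ℝ) * (R : ℝ)) ≤ (k : ℝ) ∧ MinFidelityGE (c.transmit Λ) (1 - ε)

/-- The one-way quantum capacity `Q_→(Λ)`: the supremum of the achievable rates. -/
noncomputable def oneWayCapacity (Λ : Matrix A A ℂ →ₗ[ℂ] Matrix B B ℂ) : ℝ≥0∞ :=
  ⨆ (R : ℝ≥0) (_ : OneWayAchievable Λ R), (R : ℝ≥0∞)

end Capacity

section SDP

/-- A semidefinite program in standard form over complex Hermitian matrices: minimise
`Tr (C X)` over `X ≥ 0` subject to the linear constraints `Tr (F j X) = b j`. -/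
structure SemidefiniteProgram (ι κ : Type*) where
  objective : Matrix ι ι ℂ
  objective_hermitian : objective.IsHermitian
  constraint : κ → Matrix ι ι ℂ
  constraint_hermitian : ∀ j, (constraint j).IsHermitian
  rhs : κ → ℝ

/-- `X` satisfies all constraints of the program. -/
def SemidefiniteProgram.IsFeasiblePoint {ι κ : Type*} [Fintype ι] (P : SemidefiniteProgram ι κ)
    (X : Matrix ι ι ℂ) : Prop :=
  X.PosSemidef ∧ ∀ j, (P.constraint j * X).trace = (P.rhs j : ℂ)

/-- The program has a feasible point. -/
def SemidefiniteProgram.Feasible {ι κ : Type*} [Fintype ι] (P : SemidefiniteProgram ι κ) : Prop :=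
  ∃ X, P.IsFeasiblePoint X

/-- The Hermitian matrices `E_{ij} + E_{ji}` (tag `false`) and `i (E_{ij} - E_{ji})` (tag `true`),
whose pairings with a Hermitian `M` are `2 Re M_{ij}` and `2 Im M_{ij}`. -/
def hermUnit {ι : Type*} [DecidableEq ι] : Bool × ι × ι → Matrix ι ι ℂ
  | (false, i, j) => Matrix.single i j 1 + Matrix.single j i 1
  | (true, i, j) => Complex.I • (Matrix.single i j 1 - Matrix.single j i 1)

theorem hermUnit_isHermitian {ι : Type*} [DecidableEq ι] (t : Bool × ι × ι) :
    (hermUnit t).IsHermitian := by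
  rcases t with ⟨_ | _, i, j⟩
  · simp [hermUnit, Matrix.IsHermitian, add_comm]
  · simp [hermUnit, Matrix.IsHermitian, ← smul_neg]

variable {A B : Type*} [Fintype A] [DecidableEq A] [Fintype B] [DecidableEq B]

/-- `M ⊗ 1_{B'}` on `A ⊗ B ⊗ B'`. -/
def tensorOneLast (M : Matrix (A × B) (A × B) ℂ) : Matrix (A × B × B) (A × B × B) ℂ :=
  Matrix.of fun p q => if p.2.2 = q.2.2 then M (p.1, p.2.1) (q.1, q.2.1) else 0

/-- Labels of the constraints of the symmetric-extension program: the first kind expresses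
`Tr_{B'} X = ρ`, the second kind expresses invariance of `X` under exchange of `B` and `B'`. -/
abbrev ExtConstraint (A B : Type*) : Type _ :=
  (Bool × (A × B) × (A × B)) ⊕ (Bool × (A × B × B) × (A × B × B))

/-- The semidefinite feasibility program that searches for a symmetric extension of `ρ`: the unknown
is `X ≥ 0` on `A ⊗ B ⊗ B'`, with constraints
`Tr ((H ⊗ 1) X) = Tr (H ρ)` and `Tr ((H' - V H' V) X) = 0`, where `V` exchanges `B` and `B'`, `H` and
`H'` running through the Hermitian matrices `hermUnit` on `A ⊗ B` and on `A ⊗ B ⊗ B'`. -/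
noncomputable def symExtSDP (ρ : Matrix (A × B) (A × B) ℂ) :
    SemidefiniteProgram (A × B × B) (ExtConstraint A B) where
  objective := 0
  objective_hermitian := Matrix.isHermitian_zero
  constraint
    | Sum.inl t => tensorOneLast (hermUnit t)
    | Sum.inr t => hermUnit t - (hermUnit t).submatrix swapLast swapLast
  constraint_hermitian j := by
    rcases j with t | t
    · ext p q
      have h := (hermUnit_isHermitian t).apply (p.1, p.2.1) (q.1, q.2.1)
      by_cases hpq : p.2.2 = q.2.2
      · simpa [tensorOneLast, hpq] using h
      · simp [tensorOneLast, hpq, Ne.symm hpq]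
    · exact (hermUnit_isHermitian t).sub ((hermUnit_isHermitian t).submatrix swapLast)
  rhs
    | Sum.inl t => ((hermUnit t * ρ).trace).re
    | Sum.inr _ => 0

end SDP

end QInfo

/-! Capacity: this is no-cloning. If `σ` extends the Choi state symmetrically, `d_A σ` is the Choi
matrix of a map from `A` to `B ⊗ B'` with both marginals equal to `Λ`. The classical message can be
copied, so two receivers run the same decoder, and the overall map `T` of any code has a symmetric
broadcast (`OneWayCode.isBroadcast`). Everything is expressed through values of product effects `P ⊗
Q`, so the two-receiver output state is never constructed. If `T` had high fidelity on a qubit, the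
broadcast would measure `|0⟩⟨0|` and `|+⟩⟨+|` jointly and almost sharply, which
`IsBroadcast.not_minFidelityGE` excludes with a constant independent of `n` and `k`. A positive rate
forces `k ≥ 2`, hence is not achievable.

Program: the matrices `hermUnit` separate all matrices, so the linear constraints say exactly that
`X` is swap-invariant with marginal `ρ`; trace one follows from the marginal. -/

namespace QInfo

/-! ### Positivity of pairings, Kronecker powers and ampliations. -/

section Positivity

/-- Splitting `M` into rank-one terms turns the sum into values of the quadratic form of `N` at
conjugated vectors. The pairing is `Tr (M Nᵀ)`, hence the transposes in later uses. -/
theorem sum_sum_mul_nonneg {ι : Type*} [Fintype ι] {M N : Matrix ι ι ℂ}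
    (hM : M.PosSemidef) (hN : N.PosSemidef) : 0 ≤ ∑ p, ∑ q, M p q * N p q := by
  classical
  obtain ⟨m, v, hv⟩ := posSemidef_iff_eq_sum_vecMulVec.mp hM
  have h : ∑ p, ∑ q, M p q * N p q = ∑ k, star (star (v k)) ⬝ᵥ (N *ᵥ star (v k)) := by
    subst hv
    simp only [Matrix.sum_apply, vecMulVec_apply, dotProduct, mulVec, Finset.sum_mul,
      Finset.mul_sum, star_star]
    rw [Finset.sum_congr rfl fun p _ => Finset.sum_comm, Finset.sum_comm]
    exact Finset.sum_congr rfl fun k _ => Finset.sum_congr rfl fun p _ =>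
      Finset.sum_congr rfl fun q _ => by simp only [Pi.star_apply]; ring
  rw [h]
  exact Finset.sum_nonneg fun k _ => hN.dotProduct_mulVec_nonneg _

/-- The `n`-fold Kronecker power of a matrix. -/
def kroneckerPower {ι : Type*} (n : ℕ) (M : Matrix ι ι ℂ) : Matrix (Fin n → ι) (Fin n → ι) ℂ :=
  Matrix.of fun p q => ∏ i, M (p i) (q i)

theorem posSemidef_kroneckerPower {ι : Type*} [Fintype ι] (n : ℕ) {M : Matrix ι ι ℂ}
    (hM : M.PosSemidef) : (kroneckerPower n M).PosSemidef := by
  classical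
  obtain ⟨m, v, rfl⟩ := posSemidef_iff_eq_sum_vecMulVec.mp hM
  have h : kroneckerPower n (∑ k, vecMulVec (v k) (star (v k))) =
      ∑ κ : Fin n → Fin m, vecMulVec (fun p => ∏ i, v (κ i) (p i))
        (star fun p => ∏ i, v (κ i) (p i)) := by
    ext p q
    simp only [kroneckerPower, Matrix.of_apply, Matrix.sum_apply, vecMulVec_apply,
      Finset.prod_univ_sum, Fintype.piFinset_univ, Pi.star_apply, star_prod,
      Finset.prod_mul_distrib]
  rw [h]
  exact posSemidef_sum _ fun κ _ => posSemidef_vecMulVec_self_star _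

theorem IsCompletelyPositive.posSemidef_map {A B : Type*} {Φ : Matrix A A ℂ →ₗ[ℂ] Matrix B B ℂ}
    (hΦ : IsCompletelyPositive Φ) {X : Matrix A A ℂ} (hX : X.PosSemidef) : (Φ X).PosSemidef :=
  (hΦ 1 (X.submatrix Prod.snd Prod.snd) (hX.submatrix _)).submatrix fun b => ((0 : Fin 1), b)

theorem IsCompletelyPositive.posSemidef_ampliate {A B R : Type*} [Fintype R]
    {Φ : Matrix A A ℂ →ₗ[ℂ] Matrix B B ℂ} (hΦ : IsCompletelyPositive Φ)
    {X : Matrix (R × A) (R × A) ℂ} (hX : X.PosSemidef) : (ampliate R Φ X).PosSemidef := by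
  let e := Fintype.equivFin R
  have h := (hΦ _ _ (hX.submatrix fun p : Fin (Fintype.card R) × A => (e.symm p.1, p.2))).submatrix
    fun p : R × B => (e p.1, p.2)
  convert h using 1
  ext p q
  simp [ampliate]

end Positivity

/-! ### The Choi state. -/

section Choi

variable {A B : Type*} [Fintype A] [DecidableEq A]

theorem posSemidef_maxEntangled : (maxEntangled A).PosSemidef := by
  have h : maxEntangled A = (Fintype.card A : ℂ)⁻¹ •
      vecMulVec (fun p : A × A => if p.1 = p.2 then (1 : ℂ) else 0)
        (star fun p : A × A => if p.1 = p.2 then (1 : ℂ) else 0) := by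
    ext p q
    by_cases hp : p.1 = p.2 <;> by_cases hq : q.1 = q.2 <;>
      simp [maxEntangled, vecMulVec_apply, hp, hq]
  rw [h]
  exact (posSemidef_vecMulVec_self_star _).smul (by positivity)

theorem choiState_apply (Φ : Matrix A A ℂ →ₗ[ℂ] Matrix B B ℂ) (p q : A × B) :
    choiState Φ p q = (Fintype.card A : ℂ)⁻¹ * Φ (Matrix.single p.1 q.1 1) p.2 q.2 := by
  have h : (Matrix.of fun a a' => maxEntangled A (p.1, a) (q.1, a')) =
      (Fintype.card A : ℂ)⁻¹ • Matrix.single p.1 q.1 1 := by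
    ext a a'
    simp [maxEntangled, Matrix.single]
  change Φ (Matrix.of fun a a' => maxEntangled A (p.1, a) (q.1, a')) p.2 q.2 = _
  rw [h, map_smul]
  rfl

theorem IsChannel.isDensity_choiState [Nonempty A] [Fintype B]
    {Φ : Matrix A A ℂ →ₗ[ℂ] Matrix B B ℂ} (hΦ : IsChannel Φ) : IsDensity (choiState Φ) := by
  refine ⟨hΦ.1.posSemidef_ampliate posSemidef_maxEntangled, ?_⟩
  have h (a : A) : ∑ b, Φ (Matrix.single a a 1) b b = 1 := by
    simpa [Matrix.trace] using hΦ.2 (Matrix.single a a 1)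
  simp [Matrix.trace, choiState_apply, Fintype.sum_prod_type, ← Finset.mul_sum, h]

end Choi

/-! ### The semidefinite program. -/

section Program

variable {A B : Type*} [Fintype A] [Fintype B]

theorem trace_traceLast (σ : Matrix (A × B × B) (A × B × B) ℂ) :
    (traceLast σ).trace = σ.trace := by
  simp [Matrix.trace, traceLast, Fintype.sum_prod_type]

theorem trace_tensorOneLast_mul [DecidableEq B] (M : Matrix (A × B) (A × B) ℂ)
    (σ : Matrix (A × B × B) (A × B × B) ℂ) :
    (tensorOneLast M * σ).trace = (M * traceLast σ).trace := by
  simp only [Matrix.trace, Matrix.diag_apply, Matrix.mul_apply, tensorOneLast, traceLast,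
    Matrix.of_apply, Fintype.sum_prod_type, ite_mul, zero_mul, Finset.sum_ite_eq,
    Finset.mem_univ, if_true, Finset.mul_sum]
  refine Finset.sum_congr rfl fun a _ => Finset.sum_congr rfl fun b _ => ?_
  rw [Finset.sum_comm]
  refine Finset.sum_congr rfl fun a' _ => ?_
  rw [Finset.sum_comm]

theorem trace_submatrix_swapLast_mul (M X : Matrix (A × B × B) (A × B × B) ℂ) :
    (M.submatrix swapLast swapLast * X).trace =
      (M * X.submatrix swapLast swapLast).trace := by
  let e : A × B × B ≃ A × B × B := ⟨swapLast, swapLast, fun _ => rfl, fun _ => rfl⟩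
  simp only [Matrix.trace, Matrix.diag_apply, Matrix.mul_apply, Matrix.submatrix_apply]
  refine Fintype.sum_equiv e _ _ fun p => Fintype.sum_equiv e _ _ fun q => ?_
  rfl

theorem trace_hermUnit_mul {ι : Type*} [Fintype ι] [DecidableEq ι] (i j : ι) (M : Matrix ι ι ℂ) :
    (hermUnit (false, i, j) * M).trace = M j i + M i j ∧
    (hermUnit (true, i, j) * M).trace = Complex.I * (M j i - M i j) := by
  simp [hermUnit, add_mul, sub_mul, Matrix.trace_single_mul]

/-- The pairings give the sum and difference of the `(i, j)` and `(j, i)` entries, which determine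
each entry even when the matrices are not Hermitian. -/
theorem eq_of_trace_hermUnit_mul {ι : Type*} [Fintype ι] [DecidableEq ι] {M N : Matrix ι ι ℂ}
    (h : ∀ t, (hermUnit t * M).trace = (hermUnit t * N).trace) : M = N := by
  ext i j
  have h₁ := h (false, i, j)
  have h₂ := h (true, i, j)
  rw [(trace_hermUnit_mul i j M).1, (trace_hermUnit_mul i j N).1] at h₁
  rw [(trace_hermUnit_mul i j M).2, (trace_hermUnit_mul i j N).2] at h₂
  have h₃ := mul_left_cancel₀ Complex.I_ne_zero h₂
  linear_combination (h₁ - h₃) / 2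

/-- Ensures that the real right-hand sides of the program lose no information. -/
theorem ofReal_re_trace_mul {ι : Type*} [Fintype ι] {H M : Matrix ι ι ℂ}
    (hH : H.IsHermitian) (hM : M.IsHermitian) : ((H * M).trace.re : ℂ) = (H * M).trace := by
  refine Complex.conj_eq_iff_re.mp ?_
  change star _ = _
  rw [← Matrix.trace_conjTranspose, Matrix.conjTranspose_mul, hH.eq, hM.eq, Matrix.trace_mul_comm]

theorem symmetricallyExtendible_iff_feasible [DecidableEq A] [DecidableEq B]
    {ρ : Matrix (A × B) (A × B) ℂ} (hρ : IsDensity ρ) :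
    SymmetricallyExtendible ρ ↔ (symExtSDP ρ).Feasible := by
  have hre (t) := ofReal_re_trace_mul (hermUnit_isHermitian t) hρ.1.isHermitian
  constructor
  · rintro ⟨σ, hσ, hswap, htr⟩
    refine ⟨σ, hσ.1, ?_⟩
    rintro (t | t)
    · simp only [symExtSDP]
      rw [hre, trace_tensorOneLast_mul, htr]
    · simp only [symExtSDP]
      rw [sub_mul, Matrix.trace_sub, trace_submatrix_swapLast_mul, hswap, sub_self,
        Complex.ofReal_zero]
  · rintro ⟨X, hX, hc⟩
    have htr : traceLast X = ρ := eq_of_trace_hermUnit_mul fun t => by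
      have h := hc (Sum.inl t)
      simp only [symExtSDP] at h
      rwa [hre, trace_tensorOneLast_mul] at h
    refine ⟨X, ⟨hX, ?_⟩, ?_, htr⟩
    -- Normalisation is not a constraint of the program; it is inherited from `ρ`.
    · rw [← trace_traceLast, htr, hρ.2]
    · refine (eq_of_trace_hermUnit_mul fun t => ?_).symm
      have h := hc (Sum.inr t)
      simp only [symExtSDP] at h
      rw [sub_mul, Matrix.trace_sub, trace_submatrix_swapLast_mul, Complex.ofReal_zero] at h
      exact sub_eq_zero.mp h

end Program

/-! ### Decoders acting on effects (Heisenberg picture). -/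

section Effects

variable {A B : Type*} [Fintype A] [DecidableEq A] [Fintype B]

/-- The adjoint of `Φ` for the trace pairing, `Tr (X Φ†(P)) = Tr (Φ(X) P)`. -/
def traceAdjoint (Φ : Matrix A A ℂ →ₗ[ℂ] Matrix B B ℂ) :
    Matrix B B ℂ →ₗ[ℂ] Matrix A A ℂ where
  toFun P := Matrix.of fun a' a => (Φ (Matrix.single a a' 1) * P).trace
  map_add' P Q := by ext; simp [mul_add]
  map_smul' c P := by ext; simp

theorem trace_mul_traceAdjoint (Φ : Matrix A A ℂ →ₗ[ℂ] Matrix B B ℂ) (X : Matrix A A ℂ)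
    (P : Matrix B B ℂ) : (X * traceAdjoint Φ P).trace = (Φ X * P).trace := by
  conv_rhs => rw [Matrix.matrix_eq_sum_single X]
  have h (a a' : A) : Matrix.single a a' (X a a') = X a a' • Matrix.single a a' (1 : ℂ) := by
    simp [Matrix.smul_single]
  simp only [h, map_sum, map_smul, Finset.sum_mul, Matrix.trace_sum, Matrix.smul_mul,
    Matrix.trace_smul, smul_eq_mul]
  rfl

theorem posSemidef_traceAdjoint {Φ : Matrix A A ℂ →ₗ[ℂ] Matrix B B ℂ}
    (hΦ : IsCompletelyPositive Φ) {P : Matrix B B ℂ} (hP : P.PosSemidef) :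
    (traceAdjoint Φ P).PosSemidef := by
  refine Matrix.posSemidef_iff_dotProduct_mulVec.mpr ?_
  have key (v : A → ℂ) : 0 ≤ star v ⬝ᵥ (traceAdjoint Φ P *ᵥ v) := by
    have h := sum_sum_mul_nonneg (hΦ.posSemidef_map (posSemidef_vecMulVec_self_star v))
      hP.transpose
    have e : star v ⬝ᵥ (traceAdjoint Φ P *ᵥ v) =
        (vecMulVec v (star v) * traceAdjoint Φ P).trace := by
      rw [Matrix.trace_mul_comm, Matrix.mul_vecMulVec, Matrix.trace_vecMulVec, dotProduct_comm]
    rw [e, trace_mul_traceAdjoint]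
    exact h
  refine ⟨?_, key⟩
  ext a a'
  have : Nonempty A := ⟨a⟩
  -- `Φ` commutes with the adjoint on matrix units because its Choi state is Hermitian.
  have hc (b b' : B) : star (Φ (Matrix.single a a' 1) b b') = Φ (Matrix.single a' a 1) b' b := by
    have h := (hΦ.posSemidef_ampliate posSemidef_maxEntangled).isHermitian.apply (a', b') (a, b)
    change star (choiState Φ (a, b) (a', b')) = choiState Φ (a', b') (a, b) at h
    simpa [choiState_apply] using h
  simp only [Matrix.conjTranspose_apply, traceAdjoint, LinearMap.coe_mk, AddHom.coe_mk,
    Matrix.of_apply, Matrix.trace, Matrix.diag_apply, Matrix.mul_apply, star_sum, star_mul', hc,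
    hP.isHermitian.apply]
  exact Finset.sum_comm

theorem traceAdjoint_one [DecidableEq B] {Φ : Matrix A A ℂ →ₗ[ℂ] Matrix B B ℂ}
    (hΦ : IsChannel Φ) : traceAdjoint Φ 1 = 1 := by
  ext a' a
  by_cases h : a = a'
  · subst h
    simp [traceAdjoint, hΦ.2]
  · simp [traceAdjoint, hΦ.2, Matrix.trace_single_eq_of_ne _ _ _ h, Matrix.one_apply_ne' h]

end Effects

/-! ### Product effects on the tensor power of the extended map. -/

section Joint

variable {A B : Type*} [Fintype A] [Fintype B]

/-- Interleaves `n`-tuples of basis labels of `A`, `B` and `B'`. -/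
def zipLabels {n : ℕ} (p : (Fin n → A) × (Fin n → B) × (Fin n → B)) : Fin n → A × B × B :=
  fun i => (p.1 i, p.2.1 i, p.2.2 i)

/-- For the map from `A` to `B ⊗ B'` with Choi matrix `S`, the value of the product effect
`E ⊗ F` on the output of its `n`-fold tensor power. -/
def jointValue {n : ℕ} (S : Matrix (A × B × B) (A × B × B) ℂ)
    (E F : Matrix (Fin n → B) (Fin n → B) ℂ) :
    Matrix (Fin n → A) (Fin n → A) ℂ →ₗ[ℂ] ℂ where
  toFun Y := ∑ p, ∑ q, kroneckerPower n S (zipLabels p) (zipLabels q) *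
    (Y p.1 q.1 * (E q.2.1 p.2.1 * F q.2.2 p.2.2))
  map_add' X Y := by simp only [Matrix.add_apply, add_mul, mul_add, Finset.sum_add_distrib]
  map_smul' c X := by
    simp only [Matrix.smul_apply, smul_eq_mul, Finset.mul_sum, RingHom.id_apply]
    exact Finset.sum_congr rfl fun p _ => Finset.sum_congr rfl fun q _ => by ring

variable {n : ℕ} {S : Matrix (A × B × B) (A × B × B) ℂ}

theorem jointValue_apply (S : Matrix (A × B × B) (A × B × B) ℂ)
    (E F : Matrix (Fin n → B) (Fin n → B) ℂ) (Y : Matrix (Fin n → A) (Fin n → A) ℂ) :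
    jointValue S E F Y = ∑ p, ∑ q, kroneckerPower n S (zipLabels p) (zipLabels q) *
      (Y p.1 q.1 * (E q.2.1 p.2.1 * F q.2.2 p.2.2)) := rfl

/-- The value is the entrywise pairing of the Kronecker power of `S` with `Y ⊗ Eᵀ ⊗ Fᵀ`, both
positive semidefinite. -/
theorem jointValue_nonneg (hS : S.PosSemidef) {E F : Matrix (Fin n → B) (Fin n → B) ℂ}
    (hE : E.PosSemidef) (hF : F.PosSemidef) {Y : Matrix (Fin n → A) (Fin n → A) ℂ}
    (hY : Y.PosSemidef) : 0 ≤ jointValue S E F Y :=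
  sum_sum_mul_nonneg ((posSemidef_kroneckerPower n hS).submatrix zipLabels)
    (hY.kronecker (hE.transpose.kronecker hF.transpose))

theorem jointValue_add_right (E F F' : Matrix (Fin n → B) (Fin n → B) ℂ)
    (Y : Matrix (Fin n → A) (Fin n → A) ℂ) :
    jointValue S E (F + F') Y = jointValue S E F Y + jointValue S E F' Y := by
  simp only [jointValue_apply, Matrix.add_apply, mul_add, Finset.sum_add_distrib]

theorem jointValue_comm (hS : S.submatrix swapLast swapLast = S)
    (E F : Matrix (Fin n → B) (Fin n → B) ℂ) (Y : Matrix (Fin n → A) (Fin n → A) ℂ) :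
    jointValue S E F Y = jointValue S F E Y := by
  let e : ((Fin n → A) × (Fin n → B) × (Fin n → B)) ≃ ((Fin n → A) × (Fin n → B) × (Fin n → B)) :=
    ⟨swapLast, swapLast, fun _ => rfl, fun _ => rfl⟩
  refine Fintype.sum_equiv e _ _ fun p => Fintype.sum_equiv e _ _ fun q => ?_
  have h : kroneckerPower n S (zipLabels p) (zipLabels q) =
      kroneckerPower n S (zipLabels (e p)) (zipLabels (e q)) := by
    simp only [kroneckerPower, Matrix.of_apply]
    exact Finset.prod_congr rfl fun i _ =>
      (congrFun (congrFun hS (zipLabels p i)) (zipLabels q i)).symm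
  rw [h, mul_comm (E _ _)]
  rfl

/-- The trivial effect traces out the second receiver; the sum over tuples `c` factors into
single-site sums, each an entry of `Λ`. -/
theorem jointValue_one_right [DecidableEq A] [DecidableEq B]
    {Λ : Matrix A A ℂ →ₗ[ℂ] Matrix B B ℂ}
    (hS : ∀ a a' b b', ∑ c, S (a, b, c) (a', b', c) = Λ (Matrix.single a a' 1) b b')
    (E : Matrix (Fin n → B) (Fin n → B) ℂ) (Y : Matrix (Fin n → A) (Fin n → A) ℂ) :
    jointValue S E 1 Y = (tensorPower n Λ Y * E).trace := by
  have h (a a' : Fin n → A) (b b' : Fin n → B) :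
      ∑ c : Fin n → B, kroneckerPower n S (zipLabels (a, b, c)) (zipLabels (a', b', c)) =
        ∏ i, Λ (Matrix.single (a i) (a' i) 1) (b i) (b' i) := by
    simp only [kroneckerPower, zipLabels, Matrix.of_apply, ← hS, Finset.prod_univ_sum,
      Fintype.piFinset_univ]
  simp only [jointValue_apply, Fintype.sum_prod_type, Matrix.one_apply, mul_ite, mul_one, mul_zero,
    Finset.sum_ite_eq', Finset.mem_univ, if_true]
  simp only [tensorPower, Matrix.trace, Matrix.diag_apply, Matrix.mul_apply, LinearMap.coe_mk,
    AddHom.coe_mk, Matrix.of_apply, ← h, Finset.sum_mul, Finset.mul_sum]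
  rw [Finset.sum_comm]
  refine Finset.sum_congr rfl fun b _ => ?_
  rw [Finset.sum_comm (γ := Fin n → B)]
  refine Finset.sum_congr rfl fun a _ => ?_
  rw [Finset.sum_comm]
  refine Eq.trans ?_ Finset.sum_comm
  refine Finset.sum_congr rfl fun a' _ => ?_
  rw [Finset.sum_comm]
  exact Finset.sum_congr rfl fun b' _ => Finset.sum_congr rfl fun c _ => by ring

theorem trace_tensorPower [DecidableEq A] {Λ : Matrix A A ℂ →ₗ[ℂ] Matrix B B ℂ}
    (hΛ : ∀ X, (Λ X).trace = X.trace) (Y : Matrix (Fin n → A) (Fin n → A) ℂ) :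
    (tensorPower n Λ Y).trace = Y.trace := by
  have h (a a' : Fin n → A) :
      ∑ b : Fin n → B, ∏ i, Λ (Matrix.single (a i) (a' i) 1) (b i) (b i) =
        if a = a' then 1 else 0 := by
    rw [← Fintype.piFinset_univ, ← Finset.prod_univ_sum (fun _ => Finset.univ)
      (fun i b => Λ (Matrix.single (a i) (a' i) 1) b b)]
    have h₁ (i : Fin n) : ∑ b, Λ (Matrix.single (a i) (a' i) 1) b b =
        if a i = a' i then 1 else 0 := by
      rw [show ∑ b, Λ (Matrix.single (a i) (a' i) 1) b b = _ from hΛ _]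
      split_ifs with hi
      · rw [hi, Matrix.trace_single_eq_same]
      · exact Matrix.trace_single_eq_of_ne _ _ _ hi
    simp only [h₁, Finset.prod_ite_zero, funext_iff, Finset.mem_univ, true_imp_iff,
      Finset.prod_const_one]
  simp only [Matrix.trace, Matrix.diag_apply, tensorPower, LinearMap.coe_mk, AddHom.coe_mk,
    Matrix.of_apply]
  rw [Finset.sum_comm]
  refine Finset.sum_congr rfl fun a _ => ?_
  rw [Finset.sum_comm]
  simp [← Finset.mul_sum, h]

end Joint

/-! ### Projections and a parallelogram identity. -/

section NoBroadcasting

variable {ι : Type*}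

theorem posSemidef_of_isHermitian_of_mul_self [Fintype ι] {M : Matrix ι ι ℂ} (hM : M.IsHermitian)
    (h : M * M = M) : M.PosSemidef := by
  have := posSemidef_conjTranspose_mul_self M
  rwa [hM.eq, h] at this

theorem isHermitian_vecMulVec_star [Finite ι] (u : ι → ℂ) : (vecMulVec u (star u)).IsHermitian :=
  (posSemidef_vecMulVec_self_star u).isHermitian

theorem posSemidef_one_sub_vecMulVec [Fintype ι] [DecidableEq ι]
    {u : ι → ℂ} (hu : star u ⬝ᵥ u = 1) :
    (1 - vecMulVec u (star u)).PosSemidef := by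
  refine posSemidef_of_isHermitian_of_mul_self
    (isHermitian_one.sub (isHermitian_vecMulVec_star u)) ?_
  simp [mul_sub, sub_mul, vecMulVec_mul_vecMulVec, hu]

theorem posSemidef_one_sub_vecMulVec_sub [Fintype ι] [DecidableEq ι]
    {u v : ι → ℂ} (hu : star u ⬝ᵥ u = 1)
    (hv : star v ⬝ᵥ v = 1) (huv : star u ⬝ᵥ v = 0) :
    (1 - vecMulVec u (star u) - vecMulVec v (star v)).PosSemidef := by
  have hvu : star v ⬝ᵥ u = 0 := by
    rw [← star_star (star v ⬝ᵥ u), star_dotProduct, star_star, dotProduct_comm, star_eq_zero]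
    simpa [dotProduct_comm] using huv
  refine posSemidef_of_isHermitian_of_mul_self
    ((isHermitian_one.sub (isHermitian_vecMulVec_star u)).sub (isHermitian_vecMulVec_star v)) ?_
  simp [mul_sub, sub_mul, vecMulVec_mul_vecMulVec, hu, hv, huv, hvu]

/-- The parallelogram law for `x = (x + y) - y` and `x + 2y = (x + y) + y`. -/
theorem vecMulVec_add_vecMulVec_add_two_smul (x y : ι → ℂ) :
    vecMulVec x (star x) + vecMulVec (x + (2 : ℂ) • y) (star (x + (2 : ℂ) • y)) =
      (2 : ℂ) • vecMulVec (x + y) (star (x + y)) + (2 : ℂ) • vecMulVec y (star y) := by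
  ext i j
  simp [vecMulVec_apply]
  ring

end NoBroadcasting

/-! ### Quantitative no-cloning. -/

section NoCloning

variable {k : ℕ}

/-- A family of positive functionals, additive in two effects `P`, `Q`, whose two marginals both
describe measurements on the output of a trace-preserving map `T`. -/
structure IsBroadcast (T : Matrix (Fin k) (Fin k) ℂ →ₗ[ℂ] Matrix (Fin k) (Fin k) ℂ)
    (G : Matrix (Fin k) (Fin k) ℂ → Matrix (Fin k) (Fin k) ℂ → Matrix (Fin k) (Fin k) ℂ →ₗ[ℂ] ℂ) :
    Prop where
  nonneg : ∀ {P Q ρ}, P.PosSemidef → Q.PosSemidef → ρ.PosSemidef → 0 ≤ G P Q ρ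
  add_right : ∀ P Q Q' ρ, G P (Q + Q') ρ = G P Q ρ + G P Q' ρ
  comm : ∀ P Q ρ, G P Q ρ = G Q P ρ
  marginal : ∀ P ρ, G P 1 ρ = (T ρ * P).trace
  trace : ∀ ρ, (T ρ).trace = ρ.trace

variable {T : Matrix (Fin k) (Fin k) ℂ →ₗ[ℂ] Matrix (Fin k) (Fin k) ℂ}
  {G : Matrix (Fin k) (Fin k) ℂ → Matrix (Fin k) (Fin k) ℂ → Matrix (Fin k) (Fin k) ℂ →ₗ[ℂ] ℂ}

namespace IsBroadcast

theorem le_marginal (h : IsBroadcast T G) {P Q ρ : Matrix (Fin k) (Fin k) ℂ}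
    (hP : P.PosSemidef) (hQ : (1 - Q).PosSemidef) (hρ : ρ.PosSemidef) :
    (G P Q ρ).re ≤ ((T ρ * P).trace).re := by
  have h₁ := h.add_right P Q (1 - Q) ρ
  rw [add_sub_cancel, h.marginal] at h₁
  have h₂ := (Complex.le_def.mp (h.nonneg hP hQ hρ)).1
  rw [h₁, Complex.add_re]
  simpa using h₂

theorem re_trace_mul_nonneg (h : IsBroadcast T G) {P ρ : Matrix (Fin k) (Fin k) ℂ}
    (hP : P.PosSemidef) (hρ : ρ.PosSemidef) : 0 ≤ ((T ρ * P).trace).re := by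
  rw [← h.marginal]
  exact (Complex.le_def.mp (h.nonneg hP PosSemidef.one hρ)).1

theorem re_trace_one_sub (h : IsBroadcast T G) {u : Fin k → ℂ} (hu : star u ⬝ᵥ u = 1)
    (P : Matrix (Fin k) (Fin k) ℂ) :
    ((T (vecMulVec u (star u)) * (1 - P)).trace).re =
      1 - ((T (vecMulVec u (star u)) * P).trace).re := by
  rw [mul_sub, mul_one, Matrix.trace_sub, h.trace, Matrix.trace_vecMulVec, dotProduct_comm, hu]
  simp

end IsBroadcast

theorem MinFidelityGE.le_re_trace {f : ℝ} (hT : MinFidelityGE T f) {u : Fin k → ℂ}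
    (hu : star u ⬝ᵥ u = 1) :
    f ≤ ((T (vecMulVec u (star u)) * vecMulVec u (star u)).trace).re := by
  have := hT u hu
  rwa [dotProduct_comm, ← Matrix.trace_vecMulVec, ← Matrix.mul_vecMulVec] at this

/-- The effects of `u` and `v` add up to at most `1`, and the effect of `u` already takes `1 - ε`.
-/
theorem IsBroadcast.re_trace_orthogonal_le (h : IsBroadcast T G) {ε : ℝ}
    (hT : MinFidelityGE T (1 - ε)) {u v : Fin k → ℂ} (hu : star u ⬝ᵥ u = 1)
    (hv : star v ⬝ᵥ v = 1) (huv : star u ⬝ᵥ v = 0) :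
    ((T (vecMulVec u (star u)) * vecMulVec v (star v)).trace).re ≤ ε := by
  have h₁ := h.re_trace_mul_nonneg (posSemidef_one_sub_vecMulVec_sub hu hv huv)
    (posSemidef_vecMulVec_self_star u)
  rw [sub_sub, h.re_trace_one_sub hu, mul_add, Matrix.trace_add, Complex.add_re] at h₁
  linarith [hT.le_re_trace hu]

/-- Drop the nonnegative `x + 2y` term of the parallelogram identity. An outcome unlikely on `x + y`
and on `y` is then unlikely on `x`. -/
theorem IsBroadcast.le_of_add (h : IsBroadcast T G) {P Q : Matrix (Fin k) (Fin k) ℂ}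
    (hP : P.PosSemidef) (hQ : Q.PosSemidef) (x y : Fin k → ℂ) :
    (G P Q (vecMulVec x (star x))).re ≤
      2 * (G P Q (vecMulVec (x + y) (star (x + y)))).re +
        2 * (G P Q (vecMulVec y (star y))).re := by
  have h₁ := congrArg (fun M => (G P Q M).re) (vecMulVec_add_vecMulVec_add_two_smul x y)
  have h₂ := (Complex.le_def.mp
    (h.nonneg hP hQ (posSemidef_vecMulVec_self_star (x + (2 : ℂ) • y)))).1
  simp only [map_add, map_smul, Complex.add_re, smul_eq_mul, Complex.mul_re, Complex.re_ofNat,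
    Complex.im_ofNat, zero_mul, sub_zero] at h₁
  rw [Complex.zero_re] at h₂
  linarith

/-- A map with a broadcast cannot transmit a qubit with high fidelity: the effects
`|0⟩⟨0|` and `|+⟩⟨+|` would become jointly measurable. -/
theorem IsBroadcast.not_minFidelityGE (h : IsBroadcast T G) {x y : Fin k → ℂ}
    (hx : star x ⬝ᵥ x = 1) (hy : star y ⬝ᵥ y = 1) (hxy : star x ⬝ᵥ y = 0)
    (hyx : star y ⬝ᵥ x = 0) {ε : ℝ} (hε : 13 * ε < 1) : ¬ MinFidelityGE T (1 - ε) := by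
  intro hT
  obtain ⟨s, hs, hss⟩ : ∃ s : ℂ, star s = s ∧ s * s = 1 / 2 := by
    refine ⟨((√2)⁻¹ : ℝ), Complex.conj_ofReal _, ?_⟩
    rw [← Complex.ofReal_mul, ← mul_inv, Real.mul_self_sqrt (by norm_num)]
    norm_num
  set p : Fin k → ℂ := s • (x + y) with hp
  set m : Fin k → ℂ := s • (x - y) with hm
  have hscale (w : Fin k → ℂ) :
      vecMulVec w (star w) = (2 : ℂ) • vecMulVec (s • w) (star (s • w)) := by
    rw [star_smul, hs, smul_vecMulVec, vecMulVec_smul, smul_smul, smul_smul, mul_assoc, hss]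
    norm_num
  have hpp : star p ⬝ᵥ p = 1 := by
    simp only [hp, star_smul, hs, smul_dotProduct, dotProduct_smul, star_add, add_dotProduct,
      dotProduct_add, hx, hy, hxy, hyx, smul_eq_mul]
    linear_combination 2 * hss
  have hmm : star m ⬝ᵥ m = 1 := by
    simp only [hm, star_smul, hs, smul_dotProduct, dotProduct_smul, star_sub, sub_dotProduct,
      dotProduct_sub, hx, hy, hxy, hyx, smul_eq_mul]
    linear_combination 2 * hss
  have hmp : star m ⬝ᵥ p = 0 := by
    simp [hm, hp, star_smul, hs, sub_dotProduct, hx, hy, hxy, hyx]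
  set P := vecMulVec x (star x)
  set Q := vecMulVec p (star p)
  have hP : P.PosSemidef := posSemidef_vecMulVec_self_star x
  have hQ : Q.PosSemidef := posSemidef_vecMulVec_self_star p
  have hP' : (1 - P).PosSemidef := posSemidef_one_sub_vecMulVec hx
  have hQ' : (1 - Q).PosSemidef := posSemidef_one_sub_vecMulVec hpp
  have hQ'' : (1 - (1 - Q)).PosSemidef := by rwa [sub_sub_cancel]
  have pos (w : Fin k → ℂ) := posSemidef_vecMulVec_self_star w
  -- On input `x` the first receiver almost surely finds `P`, whichever of `Q`, `1 - Q` the second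
  -- finds. Both joint outcomes turn out to be unlikely.
  have htot : 1 - ε ≤ (G P Q (vecMulVec x (star x))).re +
      (G P (1 - Q) (vecMulVec x (star x))).re := by
    rw [← Complex.add_re, ← h.add_right, add_sub_cancel, h.marginal]
    exact hT.le_re_trace hx
  have hy₁ := (h.le_marginal hP hQ' (pos y)).trans (h.re_trace_orthogonal_le hT hy hx hyx)
  have hy₂ := (h.le_marginal hP hQ'' (pos y)).trans (h.re_trace_orthogonal_le hT hy hx hyx)
  have hm₁ : (G P Q (vecMulVec m (star m))).re ≤ ε := by
    rw [h.comm]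
    exact (h.le_marginal hQ hP' (pos m)).trans (h.re_trace_orthogonal_le hT hmm hpp hmp)
  have hp₁ : (G P (1 - Q) (vecMulVec p (star p))).re ≤ ε := by
    rw [h.comm]
    refine (h.le_marginal hQ' hP' (pos p)).trans ?_
    rw [h.re_trace_one_sub hpp]
    linarith [hT.le_re_trace hpp]
  have hneg : vecMulVec (-y) (star (-y)) = vecMulVec y (star y) := by simp
  -- `x - y` is `√2 m` and `x + y` is `√2 p`, so each joint outcome has value at most `4ε + 2ε` on
  -- `x`. Hence `1 - ε ≤ 12ε`, the source of the constant 13.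
  have e₁ := h.le_of_add hP hQ x (-y)
  have e₂ := h.le_of_add hP hQ' x y
  rw [hneg, ← sub_eq_add_neg, hscale (x - y), map_smul, ← hm, smul_eq_mul] at e₁
  rw [hscale (x + y), map_smul, ← hp, smul_eq_mul] at e₂
  simp only [Complex.mul_re, Complex.re_ofNat, Complex.im_ofNat, zero_mul, sub_zero] at e₁ e₂
  linarith

end NoCloning

/-! ### Codes over a symmetrically extendible channel. -/

section Capacity

variable {A B : Type*} [Fintype A] [DecidableEq A] [Fintype B]

theorem OneWayCode.trace_transmit {n k : ℕ} (c : OneWayCode A B n k)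
    {Λ : Matrix A A ℂ →ₗ[ℂ] Matrix B B ℂ} (hΛ : IsChannel Λ) (ρ : Matrix (Fin k) (Fin k) ℂ) :
    (c.transmit Λ ρ).trace = ρ.trace := by
  simp only [OneWayCode.transmit, LinearMap.sum_apply, LinearMap.comp_apply, Matrix.trace_sum,
    (c.dec_channel _).2, trace_tensorPower hΛ.2, c.enc_trace]

variable [DecidableEq B]

/-- For each message `x`, both receivers apply `dec x`; pulling effects back through it leaves a
product effect on the two outputs, and swap-invariance of `S` makes the receivers interchangeable.
-/
theorem OneWayCode.isBroadcast {n k : ℕ} (c : OneWayCode A B n k)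
    {Λ : Matrix A A ℂ →ₗ[ℂ] Matrix B B ℂ} (hΛ : IsChannel Λ)
    {S : Matrix (A × B × B) (A × B × B) ℂ} (hS : S.PosSemidef)
    (hswap : S.submatrix swapLast swapLast = S)
    (htr : ∀ a a' b b', ∑ c, S (a, b, c) (a', b', c) = Λ (Matrix.single a a' 1) b b') :
    IsBroadcast (c.transmit Λ) fun P Q => ∑ x,
      jointValue S (traceAdjoint (c.dec x) P) (traceAdjoint (c.dec x) Q) ∘ₗ c.enc x where
  nonneg hP hQ hρ := by
    simp only [LinearMap.sum_apply, LinearMap.comp_apply]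
    exact Finset.sum_nonneg fun x _ => jointValue_nonneg hS
      (posSemidef_traceAdjoint (c.dec_channel x).1 hP)
      (posSemidef_traceAdjoint (c.dec_channel x).1 hQ) ((c.enc_cp x).posSemidef_map hρ)
  add_right P Q Q' ρ := by
    simp only [LinearMap.sum_apply, LinearMap.comp_apply, map_add, jointValue_add_right,
      Finset.sum_add_distrib]
  comm P Q ρ := by
    simp only [LinearMap.sum_apply, LinearMap.comp_apply]
    exact Finset.sum_congr rfl fun x _ => jointValue_comm hswap _ _ _
  marginal P ρ := by
    simp only [OneWayCode.transmit, LinearMap.sum_apply, LinearMap.comp_apply,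
      Finset.sum_mul, Matrix.trace_sum, traceAdjoint_one (c.dec_channel _),
      jointValue_one_right htr, trace_mul_traceAdjoint]
  trace := c.trace_transmit hΛ

theorem oneWayCapacity_eq_zero [Nonempty A] {Λ : Matrix A A ℂ →ₗ[ℂ] Matrix B B ℂ}
    (hΛ : IsChannel Λ) (h : SymmetricallyExtendible (choiState Λ)) : oneWayCapacity Λ = 0 := by
  obtain ⟨σ, hσ, hswap, htr⟩ := h
  have hd : (Fintype.card A : ℂ) ≠ 0 := Nat.cast_ne_zero.mpr Fintype.card_ne_zero
  simp only [oneWayCapacity, ENNReal.iSup_eq_zero, ENNReal.coe_eq_zero]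
  intro R hR
  by_contra hR₀
  have hpos : (0 : ℝ) < R := NNReal.coe_pos.mpr (pos_iff_ne_zero.mpr hR₀)
  -- Any error below `1/13` would do; `n > 0` is needed for `2 ^ (n R) > 1`.
  obtain ⟨n, ⟨k, c, hk, hT⟩, hn⟩ :=
    ((hR (1 / 20) (by norm_num)).and (eventually_gt_atTop 0)).exists
  have hk₂ : 1 < k := by
    have h₁ : (1 : ℝ) < 2 ^ ((n : ℝ) * (R : ℝ)) :=
      Real.one_lt_rpow (by norm_num) (mul_pos (Nat.cast_pos.mpr hn) hpos)
    exact_mod_cast h₁.trans_le hk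
  have hne : (⟨0, by omega⟩ : Fin k) ≠ ⟨1, hk₂⟩ := by simp
  -- The factor `d_A` undoes the normalisation of the Choi state.
  refine (c.isBroadcast (S := (Fintype.card A : ℂ) • σ) hΛ (hσ.1.smul (by positivity))
    (congrArg ((Fintype.card A : ℂ) • ·) hswap) ?_).not_minFidelityGE
    (x := Pi.single ⟨0, by omega⟩ 1) (y := Pi.single ⟨1, hk₂⟩ 1) ?_ ?_ ?_ ?_
    (ε := 1 / 20) (by norm_num) hT
  · intro a a' b b'
    have h₁ : ∑ c, σ (a, b, c) (a', b', c) = choiState Λ (a, b) (a', b') :=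
      congrFun (congrFun htr (a, b)) (a', b')
    simp only [Matrix.smul_apply, smul_eq_mul]
    rw [← Finset.mul_sum, h₁, choiState_apply, mul_inv_cancel_left₀ hd]
  all_goals simp [hne, hne.symm]

end Capacity

end QInfo

theorem mainTheorem2 {A B : Type*} [Fintype A] [DecidableEq A] [Nonempty A]
    [Fintype B] [DecidableEq B]
    (Λ : Matrix A A ℂ →ₗ[ℂ] Matrix B B ℂ) (hΛ : QInfo.IsChannel Λ) :
    (QInfo.SymmetricallyExtendible (QInfo.choiState Λ) → QInfo.oneWayCapacity Λ = 0) ∧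
    (QInfo.SymmetricallyExtendible (QInfo.choiState Λ) ↔
      (QInfo.symExtSDP (QInfo.choiState Λ)).Feasible) ∧
    Fintype.card (A × B × B) = Fintype.card A * Fintype.card B ^ 2 ∧
    Fintype.card (QInfo.ExtConstraint A B) =
      2 * (Fintype.card A * Fintype.card B) ^ 2 +
        2 * (Fintype.card A * Fintype.card B ^ 2) ^ 2 := by
  refine ⟨QInfo.oneWayCapacity_eq_zero hΛ,
    QInfo.symmetricallyExtendible_iff_feasible hΛ.isDensity_choiState, ?_, ?_⟩
  · simp only [Fintype.card_prod]
    ring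
  · simp only [QInfo.ExtConstraint, Fintype.card_sum, Fintype.card_prod, Fintype.card_bool]
    ring
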